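/- Let $1 \le k < d$ be integers, let $V_{d-k}(\mathbb{R}^d) = \{\mathbf{A} \in \mathbb{R}^{(d-k)\times d} : \mathbf{A}\mathbf{A}^{\mathsf T} = \mathbf{I}\}$ and let $\Xi_k = V_{d-k}(\mathbb{R}^d) \times \mathbb{R}^{d-k}$. The orthogonal group $\mathrm{O}_{d-k}(\mathbb{R})$ acts on $\Xi_k$ by $(\mathbf{A},\mathbf{t}) \mapsto (\mathbf{U}\mathbf{A},\mathbf{U}\mathbf{t})$; two points of $\Xi_k$ lie in the same orbit exactly when they define the same $k$-plane $\{\mathbf{x} : \mathbf{A}\mathbf{x}=\mathbf{t}\}$. Let $C_{0,\mathrm{iso}}(\Xi_k)$ be the space of real continuous functions $\psi$ on $\Xi_k$ that vanish at infinity and satisfy $\psi(\mathbf{U}\mathbf{A},\mathbf{U}\mathbf{t}) = \psi(\mathbf{A},\mathbf{t})$ for all $\mathbf{U}$. Let $\mathcal{M}_{\mathrm{iso}}(\Xi_k)$ be the space of finite signed Radon measures on $\Xi_k$ that are invariant under this action, with the total variation norm $\|\cdot\|_{\mathcal M}$. For $(\mathbf{A}_0,\mathbf{t}_0) \in \Xi_k$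 let $$\delta_{\mathrm{iso}}(\cdot-(\mathbf{A}_0,\mathbf{t}_0)) = \int_{\mathrm{O}_{d-k}(\mathbb{R})} \delta_{(\mathbf{U}^{-1}\mathbf{A}_0,\,\mathbf{U}^{-1}\mathbf{t}_0)} \, d\sigma(\mathbf{U}),$$ where $\delta_{\xi}$ is the unit point mass at $\xi$ and $\sigma$ is the Haar measure of $\mathrm{O}_{d-k}(\mathbb{R})$ with total mass $1$. Then $\delta_{\mathrm{iso}}(\cdot-(\mathbf{A}_0,\mathbf{t}_0)) \in \mathcal{M}_{\mathrm{iso}}(\Xi_k)$ for every $(\mathbf{A}_0,\mathbf{t}_0)\in\Xi_k$, and the following hold. 1. Sampling: for every $\psi \in C_{0,\mathrm{iso}}(\Xi_k)$, $\langle \delta_{\mathrm{iso}}(\cdot-(\mathbf{A}_0,\mathbf{t}_0)), \psi\rangle = \psi(\mathbf{A}_0,\mathbf{t}_0)$. 2. Rotation invariance: for every $\mathbf{U} \in \mathrm{O}_{d-k}(\mathbb{R})$, $\delta_{\mathrm{iso}}(\cdot-(\mathbf{A}_0,\mathbf{t}_0)) = \delta_{\mathrm{iso}}(\cdot-(\mathbf{U}\mathbf{A}_0,\mathbf{U}\mathbf{t}_0))$.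 3. Unit norm: $\|\delta_{\mathrm{iso}}(\cdot-(\mathbf{A}_0,\mathbf{t}_0))\|_{\mathcal M} = 1$. 4. Linear combination: for all points $(\mathbf{A}_1,\mathbf{t}_1),\dots,(\mathbf{A}_N,\mathbf{t}_N) \in \Xi_k$ that lie in pairwise distinct $\mathrm{O}_{d-k}(\mathbb{R})$-orbits (that is, define pairwise distinct $k$-planes) and all $a_1,\dots,a_N \in \mathbb{R}$, $$\Bigl\|\sum_{n=1}^N a_n\, \delta_{\mathrm{iso}}(\cdot-(\mathbf{A}_n,\mathbf{t}_n))\Bigr\|_{\mathcal M} = \sum_{n=1}^N |a_n|.$$ 5. Extreme points: every extreme point of the unit ball $\{e \in \mathcal{M}_{\mathrm{iso}}(\Xi_k) : \|e\|_{\mathcal M} \le 1\}$ is of the form $\pm\delta_{\mathrm{iso}}(\cdot-(\mathbf{A}_0,\mathbf{t}_0))$ for some $(\mathbf{A}_0,\mathbf{t}_0) \in \Xi_k$. -/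

import Mathlib

open MeasureTheory

/-! ### The orthogonal group and its normalized Haar measure -/

/-- The orthogonal group `O_n(ℝ)`, with the subspace topology of the matrix space. -/
abbrev OrthGroup (n : ℕ) : Type := Matrix.orthogonalGroup (Fin n) ℝ

instance OrthGroup.instMeasurableSpace (n : ℕ) : MeasurableSpace (OrthGroup n) := borel _

instance OrthGroup.instBorelSpace (n : ℕ) : BorelSpace (OrthGroup n) := ⟨rfl⟩

theorem OrthGroup.mul_transpose_coe {n : ℕ} (U : OrthGroup n) :
    (U : Matrix (Fin n) (Fin n) ℝ) * (U : Matrix (Fin n) (Fin n) ℝ).transpose = 1 :=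
  (Matrix.mem_orthogonalGroup_iff (Fin n) ℝ).1 U.2

instance OrthGroup.instCompactSpace (n : ℕ) : CompactSpace (OrthGroup n) := by
  let S : Set (Matrix (Fin n) (Fin n) ℝ) := {M | M ∈ Matrix.orthogonalGroup (Fin n) ℝ}
  have hS : IsClosed S := by
    have h : S = {M : Matrix (Fin n) (Fin n) ℝ | M * M.transpose = 1} := by
      ext M; exact Matrix.mem_orthogonalGroup_iff (Fin n) ℝ
    rw [h]
    exact isClosed_eq (by fun_prop) continuous_const
  have hK : IsCompact
      (Set.univ.pi (fun _ => Set.univ.pi (fun _ => Set.Icc (-1 : ℝ) 1)) :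
        Set (Fin n → Fin n → ℝ)) :=
    isCompact_univ_pi (fun _ => isCompact_univ_pi (fun _ => isCompact_Icc))
  have hsub : S ⊆ (Set.univ.pi (fun _ => Set.univ.pi (fun _ => Set.Icc (-1 : ℝ) 1)) :
        Set (Fin n → Fin n → ℝ)) := by
    intro M hM i _ j _
    have h1 : (M * M.transpose) i i = 1 := by
      rw [(Matrix.mem_orthogonalGroup_iff (Fin n) ℝ).1 hM]; simp
    rw [Matrix.mul_apply] at h1
    have h2 : M i j * M i j ≤ 1 := by
      rw [← h1]
      exact Finset.single_le_sum (f := fun j => M i j * M.transpose j i)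
        (fun j _ => mul_self_nonneg (M i j)) (Finset.mem_univ j)
    exact abs_le.1 (abs_le_one_iff_mul_self_le_one.2 h2)
  exact isCompact_iff_compactSpace.1 (hK.of_isClosed_subset hS hsub)

/-- The Haar measure `σ` of `O_n(ℝ)`, normalized to total mass one. Integrals against it are
average integrals over `O_n(ℝ)`. -/
noncomputable def OrthGroup.haarProb (n : ℕ) : Measure (OrthGroup n) :=
  Measure.haarMeasure ⊤

instance OrthGroup.instIsProbabilityMeasure (n : ℕ) :
    IsProbabilityMeasure (OrthGroup.haarProb n) :=
  ⟨by simpa using! Measure.haarMeasure_self (K₀ := (⊤ : TopologicalSpace.PositiveCompacts (OrthGroup n)))⟩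

/-! ### The `k`-plane domain -/

/-- The Stiefel manifold `V_m(ℝ^d)` of real `m × d` matrices with orthonormal rows, with the
subspace topology. -/
abbrev Stiefel (m d : ℕ) : Type :=
  {A : Matrix (Fin m) (Fin d) ℝ // A * A.transpose = 1}

instance Stiefel.instSecondCountableTopology (m d : ℕ) :
    SecondCountableTopology (Stiefel m d) :=
  @TopologicalSpace.Subtype.secondCountableTopology (Matrix (Fin m) (Fin d) ℝ) _ _
    (inferInstanceAs (SecondCountableTopology (Fin m → Fin d → ℝ)))

instance Stiefel.instMeasurableSpace (m d : ℕ) : MeasurableSpace (Stiefel m d) := borel _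

instance Stiefel.instBorelSpace (m d : ℕ) : BorelSpace (Stiefel m d) := ⟨rfl⟩

/-- The `k`-plane domain `Ξ_k = V_{d-k}(ℝ^d) × ℝ^{d-k}`. Only the topology and the Borel
structure of `ℝ^{d-k}` are used. -/
abbrev KPlaneDomain (d k : ℕ) : Type := Stiefel (d - k) d × (Fin (d - k) → ℝ)

/-- The action `(A, t) ↦ (U A, U t)` of `U ∈ O_{d-k}(ℝ)` on `Ξ_k`. -/
def KPlaneDomain.rotate {d k : ℕ} (U : OrthGroup (d - k)) (ξ : KPlaneDomain d k) :
    KPlaneDomain d k :=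
  (⟨(U : Matrix (Fin (d - k)) (Fin (d - k)) ℝ) * ξ.1.1, by
      rw [Matrix.transpose_mul, Matrix.mul_assoc, ← Matrix.mul_assoc ξ.1.1, ξ.1.2,
        Matrix.one_mul, OrthGroup.mul_transpose_coe]⟩,
    Matrix.mulVec (U : Matrix (Fin (d - k)) (Fin (d - k)) ℝ) ξ.2)

/-! ### Isotropic functions and measures

`Ξ_k` is a second countable locally compact Hausdorff space, so its finite signed Borel measures
are exactly its finite (signed) Radon measures. -/

/-- Membership in `C_{0,iso}(Ξ_k)`: `ψ(U A, U t) = ψ(A, t)` for all `(A, t)` and `U`. -/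
def IsIsotropic {d k : ℕ} (ψ : ZeroAtInftyContinuousMap (KPlaneDomain d k) ℝ) : Prop :=
  ∀ (U : OrthGroup (d - k)) (ξ : KPlaneDomain d k), ψ (KPlaneDomain.rotate U ξ) = ψ ξ

/-- The space `M_iso(Ξ_k)` of finite signed measures on `Ξ_k` that are invariant under every
rotation `(A, t) ↦ (U A, U t)`. -/
def measIso (d k : ℕ) : Submodule ℝ (SignedMeasure (KPlaneDomain d k)) where
  carrier := {μ | ∀ U : OrthGroup (d - k), μ.map (KPlaneDomain.rotate U) = μ}
  zero_mem' := fun _ => VectorMeasure.map_zero _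
  add_mem' := fun hμ hν U => by rw [VectorMeasure.map_add, hμ U, hν U]
  smul_mem' := fun c μ hμ U => by rw [VectorMeasure.map_smul, hμ U]

/-- The norm of `M(Ξ_k)`: the total variation of a finite signed measure. -/
noncomputable def measNorm {d k : ℕ} (μ : SignedMeasure (KPlaneDomain d k)) : ℝ :=
  μ.totalVariation.real Set.univ

/-- The unit ball of `M_iso(Ξ_k)`. -/
def measIsoBall (d k : ℕ) : Set (SignedMeasure (KPlaneDomain d k)) :=
  {μ | μ ∈ measIso d k ∧ measNorm μ ≤ 1}

/-! ### The isotropic Dirac impulse -/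

/-- The isotropic projection of a positive measure on `Ξ_k`: the average over `U ∈ O_{d-k}(ℝ)`
of the "generalized function" `ξ ↦ μ(U ξ)`, that is, of the image of `μ` under `U⁻¹`. -/
noncomputable def isoProj {d k : ℕ} (μ : Measure (KPlaneDomain d k)) :
    Measure (KPlaneDomain d k) :=
  (OrthGroup.haarProb (d - k)).bind (fun U => μ.map (KPlaneDomain.rotate U⁻¹))

instance isoProj.instIsFiniteMeasure {d k : ℕ} (μ : Measure (KPlaneDomain d k))
    [IsFiniteMeasure μ] : IsFiniteMeasure (isoProj μ) := by
  refine ⟨(Measure.bind_apply_le _ MeasurableSet.univ).trans_lt ?_⟩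
  refine (lintegral_mono (g := fun _ => μ Set.univ) (fun U => ?_)).trans_lt ?_
  · by_cases h : AEMeasurable (KPlaneDomain.rotate U⁻¹) μ
    · rw [Measure.map_apply_of_aemeasurable h MeasurableSet.univ, Set.preimage_univ]
    · rw [Measure.map_of_not_aemeasurable h]; simp
  · simp

/-- The isotropic shifted Dirac impulse `δ_iso(· - ξ₀)`, the isotropic projection of the point
mass at `ξ₀`. -/
noncomputable def diracIso {d k : ℕ} (ξ₀ : KPlaneDomain d k) :
    SignedMeasure (KPlaneDomain d k) :=
  (isoProj (Measure.dirac ξ₀)).toSignedMeasure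

/-!
The theorem holds for any compact group `G` acting continuously on a second countable Hausdorff
space `X`; the law of `g • x` for a Haar distributed `g` plays the role of the isotropic Dirac
impulse at `x`. These laws are carried by the orbits, which are pairwise disjoint compact sets, and
this gives the norm of a linear combination.

An extreme point `μ` of the unit ball cannot charge both an invariant set and its complement:
otherwise the normalized restrictions of `μ` to the two sets would exhibit it as a proper convex
combination. The action is proper, so the orbit space is Hausdorff and second countable, and
countably many invariant open sets separate the orbits; hence `|μ|` is carried by a single orbit.
Averaging over `G` shows that an invariant measure carried by the orbit of `x` is a multiple of the
law of `g • x`, and the factor is `±1` because `μ` has norm one.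
-/

open Set Filter Function

section ExtremePoints

variable {E : Type*} [AddCommGroup E] [Module ℝ E] {p : Seminorm ℝ E} {M : Submodule ℝ E}

theorem eq_zero_of_mem_extremePoints_seminormBall {e y : E}
    (he : e ∈ extremePoints ℝ {x | x ∈ M ∧ p x ≤ 1}) (hy : y ∈ M) (hle : p e + p y ≤ 1) :
    y = 0 := by
  have hadd : e + y ∈ {x | x ∈ M ∧ p x ≤ 1} :=
    ⟨M.add_mem he.1.1 hy, (map_add_le_add p e y).trans hle⟩
  have hsub : e - y ∈ {x | x ∈ M ∧ p x ≤ 1} :=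
    ⟨M.sub_mem he.1.1 hy, (map_sub_le_add p e y).trans hle⟩
  have hmid : e ∈ openSegment ℝ (e + y) (e - y) :=
    ⟨1 / 2, 1 / 2, by norm_num, by norm_num, by norm_num, by module⟩
  exact add_eq_left.1 (he.2 hadd hsub hmid)

theorem seminorm_eq_one_of_mem_extremePoints_seminormBall {e z : E}
    (he : e ∈ extremePoints ℝ {x | x ∈ M ∧ p x ≤ 1}) (hz : z ∈ M) (hpz : p z ≠ 0) :
    p e = 1 := by
  have hgap : 0 ≤ 1 - p e := sub_nonneg.2 he.1.2
  have hp : p (((1 - p e) / p z) • z) = 1 - p e := by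
    rw [map_smul_eq_mul, Real.norm_of_nonneg (div_nonneg hgap (apply_nonneg p z)),
      div_mul_cancel₀ _ hpz]
  have hzero : ((1 - p e) / p z) • z = 0 :=
    eq_zero_of_mem_extremePoints_seminormBall he (M.smul_mem _ hz) (by rw [hp]; linarith)
  rw [hzero, map_zero] at hp
  linarith

theorem eq_smul_of_add_mem_extremePoints_seminormBall {x y : E}
    (he : x + y ∈ extremePoints ℝ {x | x ∈ M ∧ p x ≤ 1}) (hx : x ∈ M) (hy : y ∈ M)
    (hadd : p (x + y) = p x + p y) (hpx : 0 < p x) (hpy : 0 < p y) :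
    x = p x • (x + y) := by
  have hone : p x + p y = 1 := hadd ▸
    seminorm_eq_one_of_mem_extremePoints_seminormBall he hx hpx.ne'
  have hball {z : E} (hz : z ∈ M) (hpz : 0 < p z) :
      (p z)⁻¹ • z ∈ {x | x ∈ M ∧ p x ≤ 1} :=
    ⟨M.smul_mem _ hz, by
      rw [map_smul_eq_mul, norm_inv, Real.norm_of_nonneg hpz.le, inv_mul_cancel₀ hpz.ne']⟩
  have hmid : x + y ∈ openSegment ℝ ((p x)⁻¹ • x) ((p y)⁻¹ • y) :=
    ⟨p x, p y, hpx, hpy, hone, by rw [smul_inv_smul₀ hpx.ne', smul_inv_smul₀ hpy.ne']⟩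
  rw [← he.2 (hball hx hpx) (hball hy hpy) hmid, smul_inv_smul₀ hpx.ne']

end ExtremePoints

section TotalVariation

variable {α β : Type*} [MeasurableSpace α] [MeasurableSpace β]

instance isFiniteMeasure_variation_signedMeasure (μ : SignedMeasure α) :
    IsFiniteMeasure μ.variation := by
  rw [← SignedMeasure.totalVariation_eq_variation, SignedMeasure.totalVariation]
  infer_instance

/-- The total variation norm on the signed measures on `α`. It is bundled as a seminorm instead of
being registered as a norm instance on `SignedMeasure α`. -/
noncomputable def totalVariationNorm (α : Type*) [MeasurableSpace α] :
    Seminorm ℝ (SignedMeasure α) :=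
  Seminorm.of (fun μ => μ.totalVariation.real univ)
    (fun μ ν => by
      simp only [SignedMeasure.totalVariation_eq_variation]
      rw [← measureReal_add_apply]
      exact ENNReal.toReal_mono (measure_ne_top _ _) (VectorMeasure.variation_add_le univ))
    (fun c μ => by
      simp [SignedMeasure.totalVariation_eq_variation, VectorMeasure.variation_smul])

theorem totalVariationNorm_apply (μ : SignedMeasure α) :
    totalVariationNorm α μ = μ.variation.real univ := by
  rw [← SignedMeasure.totalVariation_eq_variation]
  rfl

theorem totalVariationNorm_toSignedMeasure (μ : Measure α) [IsFiniteMeasure μ] :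
    totalVariationNorm α μ.toSignedMeasure = μ.real univ := by
  rw [totalVariationNorm_apply, Measure.variation_toSignedMeasure]

theorem totalVariationNorm_restrict (μ : SignedMeasure α) {s : Set α} (hs : MeasurableSet s) :
    totalVariationNorm α (μ.restrict s) = μ.variation.real s := by
  rw [totalVariationNorm_apply, VectorMeasure.variation_restrict hs,
    measureReal_restrict_apply_univ]

theorem sum_abs_apply_le_totalVariationNorm {ι : Type*} [Fintype ι] (μ : SignedMeasure α)
    {s : ι → Set α} (hs : ∀ i, MeasurableSet (s i)) (hdisj : Pairwise (Disjoint on s)) :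
    ∑ i, |μ (s i)| ≤ totalVariationNorm α μ :=
  calc ∑ i, |μ (s i)| ≤ ∑ i, μ.variation.real (s i) :=
        Finset.sum_le_sum fun _ _ =>
          VectorMeasure.norm_measure_le_variation (μ := μ) (measure_ne_top _ _)
    _ = μ.variation.real (⋃ i, s i) := (measureReal_iUnion_fintype hdisj hs).symm
    _ ≤ μ.variation.real univ := measureReal_mono (subset_univ _)
    _ = totalVariationNorm α μ := (totalVariationNorm_apply μ).symm

theorem map_toSignedMeasure (μ : Measure α) [IsFiniteMeasure μ] {f : α → β} (hf : Measurable f) :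
    μ.toSignedMeasure.map f = (μ.map f).toSignedMeasure := by
  ext s hs
  rw [VectorMeasure.map_apply _ hf hs, Measure.toSignedMeasure_apply_measurable (hf hs),
    Measure.toSignedMeasure_apply_measurable hs, map_measureReal_apply hf hs]

/-- The image of a Jordan decomposition under `f`, used to see that the positive and negative parts
of an invariant signed measure are invariant. Injectivity of `f` keeps the two parts mutually
singular. -/
noncomputable def jordanDecompositionMap (j : JordanDecomposition α) {f : α → β}
    (hf : MeasurableEmbedding f) : JordanDecomposition β where
  posPart := j.posPart.map f
  negPart := j.negPart.map f
  posPart_finite := inferInstance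
  negPart_finite := inferInstance
  mutuallySingular := hf.mutuallySingular_map j.mutuallySingular

theorem toJordanDecomposition_map (μ : SignedMeasure α) {f : α → β} (hf : MeasurableEmbedding f) :
    SignedMeasure.toJordanDecomposition (μ.map f) =
      jordanDecompositionMap μ.toJordanDecomposition hf := by
  refine SignedMeasure.toJordanDecomposition_eq ?_
  ext s hs
  conv_lhs => rw [← SignedMeasure.toSignedMeasure_toJordanDecomposition μ]
  rw [VectorMeasure.map_apply _ hf.measurable hs, JordanDecomposition.toSignedMeasure,
    JordanDecomposition.toSignedMeasure, Measure.toSignedMeasure_sub_apply hs,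
    Measure.toSignedMeasure_sub_apply (hf.measurable hs)]
  simp only [jordanDecompositionMap, map_measureReal_apply hf.measurable hs]

theorem absolutelyContinuous_posPart_variation (μ : SignedMeasure α) :
    μ.toJordanDecomposition.posPart ≪ μ.variation := by
  rw [← SignedMeasure.totalVariation_eq_variation, SignedMeasure.totalVariation]
  exact .add_right .rfl _

theorem absolutelyContinuous_negPart_variation (μ : SignedMeasure α) :
    μ.toJordanDecomposition.negPart ≪ μ.variation := by
  rw [← SignedMeasure.totalVariation_eq_variation, SignedMeasure.totalVariation, add_comm]
  exact .add_right .rfl _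

end TotalVariation

section InvariantSignedMeasures

variable {G X : Type*} [MeasurableSpace X]

/-- The space of signed measures on `X` that are invariant under every element of `G`. It is
`measIso d k` for the action of `OrthGroup (d - k)` on `KPlaneDomain d k` by rotations. -/
def invariantSignedMeasures (G X : Type*) [SMul G X] [MeasurableSpace X] :
    Submodule ℝ (SignedMeasure X) where
  carrier := {μ | ∀ g : G, μ.map (g • ·) = μ}
  zero_mem' := fun _ => VectorMeasure.map_zero _
  add_mem' := fun hμ hν g => by rw [VectorMeasure.map_add, hμ g, hν g]
  smul_mem' := fun c μ hμ g => by rw [VectorMeasure.map_smul, hμ g]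

theorem toSignedMeasure_mem_invariantSignedMeasures [SMul G X] [MeasurableConstSMul G X]
    (μ : Measure X) [IsFiniteMeasure μ] [SMulInvariantMeasure G X μ] :
    μ.toSignedMeasure ∈ invariantSignedMeasures G X := fun g =>
  (map_toSignedMeasure μ (measurable_const_smul g)).trans
    (Measure.toSignedMeasure_congr ((measurePreserving_smul g μ).map_eq))

theorem restrict_mem_invariantSignedMeasures [SMul G X] [MeasurableConstSMul G X]
    {μ : SignedMeasure X} (hμ : μ ∈ invariantSignedMeasures G X) {B : Set X}
    (hB : MeasurableSet B) (hinv : ∀ g : G, (g • ·) ⁻¹' B = B) :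
    μ.restrict B ∈ invariantSignedMeasures G X := fun g => by
  conv_rhs => rw [← hμ g, VectorMeasure.restrict_map μ (measurable_const_smul g) hB, hinv]

theorem toJordanDecomposition_map_smul [Group G] [MulAction G X] [MeasurableConstSMul G X]
    {μ : SignedMeasure X} (hμ : μ ∈ invariantSignedMeasures G X) (g : G) :
    jordanDecompositionMap μ.toJordanDecomposition (measurableEmbedding_const_smul g) =
      μ.toJordanDecomposition := by
  rw [← toJordanDecomposition_map, hμ g]

theorem smulInvariantMeasure_posPart [Group G] [MulAction G X] [MeasurableConstSMul G X]
    {μ : SignedMeasure X} (hμ : μ ∈ invariantSignedMeasures G X) :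
    SMulInvariantMeasure G X μ.toJordanDecomposition.posPart :=
  ⟨fun g s hs => by
    conv_rhs => rw [← toJordanDecomposition_map_smul hμ g]
    exact (Measure.map_apply (measurable_const_smul g) hs).symm⟩

theorem smulInvariantMeasure_negPart [Group G] [MulAction G X] [MeasurableConstSMul G X]
    {μ : SignedMeasure X} (hμ : μ ∈ invariantSignedMeasures G X) :
    SMulInvariantMeasure G X μ.toJordanDecomposition.negPart :=
  ⟨fun g s hs => by
    conv_rhs => rw [← toJordanDecomposition_map_smul hμ g]
    exact (Measure.map_apply (measurable_const_smul g) hs).symm⟩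

/-- The unit ball of the invariant signed measures on `X` for the total variation norm. It
generalizes `measIsoBall`. -/
def invariantUnitBall (G X : Type*) [SMul G X] [MeasurableSpace X] : Set (SignedMeasure X) :=
  {μ | μ ∈ invariantSignedMeasures G X ∧ totalVariationNorm X μ ≤ 1}

theorem variation_eq_zero_or_compl_of_mem_extremePoints [SMul G X] [MeasurableConstSMul G X]
    {μ : SignedMeasure X} (hμ : μ ∈ extremePoints ℝ (invariantUnitBall G X)) {B : Set X}
    (hB : MeasurableSet B) (hinv : ∀ g : G, (g • ·) ⁻¹' B = B) :
    μ.variation B = 0 ∨ μ.variation Bᶜ = 0 := by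
  by_contra! hne
  have hpos {s : Set X} (hs : μ.variation s ≠ 0) : 0 < μ.variation.real s :=
    ENNReal.toReal_pos hs (measure_ne_top _ s)
  have hsplit : μ.restrict B + μ.restrict Bᶜ = μ := VectorMeasure.restrict_add_restrict_compl hB
  have hprop : μ.restrict B = μ.variation.real B • μ := by
    have h := eq_smul_of_add_mem_extremePoints_seminormBall (p := totalVariationNorm X)
      (hsplit.symm ▸ hμ) (restrict_mem_invariantSignedMeasures hμ.1.1 hB hinv)
      (restrict_mem_invariantSignedMeasures hμ.1.1 hB.compl fun g => by
        rw [preimage_compl, hinv g])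
    rw [hsplit, totalVariationNorm_restrict μ hB, totalVariationNorm_restrict μ hB.compl,
      totalVariationNorm_apply, measureReal_add_measureReal_compl hB] at h
    exact h rfl (hpos hne.1) (hpos hne.2)
  have hcompl : μ.variation.real B • μ.restrict Bᶜ = 0 := by
    rw [← VectorMeasure.restrict_smul, ← hprop, VectorMeasure.restrict_restrict μ hB.compl hB,
      compl_inter_self, VectorMeasure.restrict_empty]
  have hzero := (smul_eq_zero.1 hcompl).resolve_left (hpos hne.1).ne'
  refine hne.2 ?_
  rw [← measureReal_eq_zero_iff, ← totalVariationNorm_restrict μ hB.compl, hzero, map_zero]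

theorem exists_ae_mem_orbit_of_forall_measure_eq_zero_or_compl [Group G]
    [MulAction G X] [TopologicalSpace X] [ContinuousConstSMul G X] [SecondCountableTopology X]
    [T0Space (MulAction.orbitRel.Quotient G X)] [Nonempty X]
    [OpensMeasurableSpace X] (μ : Measure X)
    (hμ : ∀ B, MeasurableSet B → (∀ g : G, (g • ·) ⁻¹' B = B) → μ B = 0 ∨ μ Bᶜ = 0) :
    ∃ x, ∀ᵐ y ∂μ, y ∈ MulAction.orbit G x := by
  let π : X → MulAction.orbitRel.Quotient G X := Quotient.mk _
  have : Nonempty (MulAction.orbitRel.Quotient G X) := .map π ‹_›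
  have := ContinuousConstSMul.secondCountableTopology (Γ := G) (T := X)
  have hsep (U : Set (MulAction.orbitRel.Quotient G X)) (hU : IsOpen U) :
      (∀ᵐ y ∂μ, π y ∈ U) ∨ ∀ᵐ y ∂μ, π y ∉ U := by
    refine (hμ (π ⁻¹' U) (hU.preimage continuous_quot_mk).measurableSet fun g => ?_).symm.imp id ?_
    · have hπ (y : X) : π (g • y) = π y := Quotient.sound (MulAction.mem_orbit y g)
      simp only [preimage_preimage, hπ]
    · exact measure_eq_zero_iff_ae_notMem.1
  obtain ⟨q, hq⟩ := exists_eventuallyEq_const_of_forall_separating IsOpen hsep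
  obtain ⟨x, rfl⟩ := Quotient.exists_rep q
  exact ⟨x, hq.mono fun y hy => Quotient.exact hy⟩

end InvariantSignedMeasures

section OrbitMeasure

variable {G X E : Type*} [MeasurableSpace G] [MeasurableSpace X] [NormedAddCommGroup E]

/-- The law of `g • x` for a random element `g` of `G` with law `σ`. If `σ` is the Haar probability
measure of a compact group, this is the invariant probability measure on the orbit of `x`; averaging
over `g⁻¹ • x` instead, as in `isoProj`, gives the same measure. -/
noncomputable def orbitMeasure [SMul G X] (σ : Measure G) (x : X) : Measure X :=
  σ.map (· • x)

instance isFiniteMeasure_orbitMeasure [SMul G X] (σ : Measure G) [IsFiniteMeasure σ] (x : X) :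
    IsFiniteMeasure (orbitMeasure σ x) :=
  inferInstanceAs (IsFiniteMeasure (σ.map (· • x)))

theorem orbitMeasure_apply [SMul G X] [MeasurableSMul G X] (σ : Measure G) (x : X) {s : Set X}
    (hs : MeasurableSet s) : orbitMeasure σ x s = σ ((· • x) ⁻¹' s) :=
  Measure.map_apply (measurable_smul_const x) hs

instance isProbabilityMeasure_orbitMeasure [SMul G X] [MeasurableSMul G X] (σ : Measure G)
    [IsProbabilityMeasure σ] (x : X) : IsProbabilityMeasure (orbitMeasure σ x) :=
  Measure.isProbabilityMeasure_map (measurable_smul_const x).aemeasurable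

theorem integrable_orbitMeasure_of_forall_smul_eq [SMul G X] [MeasurableSMul G X]
    (σ : Measure G) [IsFiniteMeasure σ] {x : X} {f : X → E} (hf : StronglyMeasurable f)
    (hinv : ∀ g : G, f (g • x) = f x) : Integrable f (orbitMeasure σ x) := by
  refine (integrable_map_measure hf.aestronglyMeasurable
    (measurable_smul_const x).aemeasurable).2 ?_
  simp only [comp_def, hinv, integrable_const]

theorem integral_orbitMeasure_of_forall_smul_eq [SMul G X] [MeasurableSMul G X]
    [NormedSpace ℝ E] [CompleteSpace E] (σ : Measure G) [IsProbabilityMeasure σ] {x : X}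
    {f : X → E} (hf : StronglyMeasurable f) (hinv : ∀ g : G, f (g • x) = f x) :
    ∫ y, f y ∂(orbitMeasure σ x) = f x := by
  rw [orbitMeasure, integral_map (measurable_smul_const x).aemeasurable hf.aestronglyMeasurable]
  simp only [hinv, integral_const, probReal_univ, one_smul]

theorem totalVariationNorm_orbitMeasure [SMul G X] [MeasurableSMul G X] (σ : Measure G)
    [IsProbabilityMeasure σ] (x : X) :
    totalVariationNorm X (orbitMeasure σ x).toSignedMeasure = 1 := by
  rw [totalVariationNorm_toSignedMeasure, probReal_univ]

section Group

variable [Group G] [MulAction G X] (σ : Measure G)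

instance smulInvariantMeasure_orbitMeasure [MeasurableMul G] [MeasurableSMul G X]
    [σ.IsMulLeftInvariant] (x : X) : SMulInvariantMeasure G X (orbitMeasure σ x) where
  measure_preimage_smul g s hs := by
    rw [orbitMeasure_apply σ x hs, orbitMeasure_apply σ x (measurable_const_smul g hs),
      ← measure_preimage_mul σ g ((· • x) ⁻¹' s)]
    simp only [preimage_preimage, mul_smul]

theorem orbitMeasure_smul [MeasurableMul G] [MeasurableSMul G X] [σ.IsMulRightInvariant]
    (g : G) (x : X) : orbitMeasure σ (g • x) = orbitMeasure σ x := by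
  ext s hs
  rw [orbitMeasure_apply σ _ hs, orbitMeasure_apply σ x hs,
    ← measure_preimage_mul_right σ g ((· • x) ⁻¹' s)]
  simp only [preimage_preimage, mul_smul]

theorem orbitMeasure_apply_orbit [MeasurableSMul G X] [IsProbabilityMeasure σ] {x : X}
    (hx : MeasurableSet (MulAction.orbit G x)) : orbitMeasure σ x (MulAction.orbit G x) = 1 := by
  have h : (fun g : G => g • x) ⁻¹' MulAction.orbit G x = univ :=
    eq_univ_of_forall fun g => MulAction.mem_orbit x g
  rw [orbitMeasure_apply σ x hx, h, measure_univ]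

theorem orbitMeasure_apply_orbit_of_notMem [MeasurableSMul G X] {x y : X}
    (hy : MeasurableSet (MulAction.orbit G y)) (hxy : x ∉ MulAction.orbit G y) :
    orbitMeasure σ x (MulAction.orbit G y) = 0 := by
  have h : (fun g : G => g • x) ⁻¹' MulAction.orbit G y = ∅ :=
    eq_empty_of_forall_notMem fun g hg =>
      hxy (inv_smul_smul g x ▸ MulAction.mem_orbit_of_mem_orbit g⁻¹ hg)
  rw [orbitMeasure_apply σ x hy, h, measure_empty]

theorem totalVariationNorm_sum_smul_orbitMeasure [MeasurableSMul G X] [IsProbabilityMeasure σ]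
    {ι : Type*} [Fintype ι] {x : ι → X} (hmeas : ∀ i, MeasurableSet (MulAction.orbit G (x i)))
    (hx : ∀ i j, i ≠ j → ∀ g : G, x i ≠ g • x j) (a : ι → ℝ) :
    totalVariationNorm X (∑ i, a i • (orbitMeasure σ (x i)).toSignedMeasure) = ∑ i, |a i| := by
  classical
  have hnotMem {i j : ι} (hij : i ≠ j) : x i ∉ MulAction.orbit G (x j) :=
    fun ⟨g, hg⟩ => hx i j hij g hg.symm
  have hdisj : Pairwise (Disjoint on fun i => MulAction.orbit G (x i)) := fun i j hij =>
    (MulAction.orbit.eq_or_disjoint (x i) (x j)).resolve_left fun h =>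
      hnotMem hij (MulAction.orbit_eq_iff.1 h)
  have hval (j : ι) : (∑ i, a i • (orbitMeasure σ (x i)).toSignedMeasure)
      (MulAction.orbit G (x j)) = a j := by
    have hdirac (i : ι) : (orbitMeasure σ (x i)).real (MulAction.orbit G (x j)) =
        if i = j then 1 else 0 := by
      split_ifs with h
      · rw [h, measureReal_def, orbitMeasure_apply_orbit σ (hmeas j), ENNReal.toReal_one]
      · rw [measureReal_def, orbitMeasure_apply_orbit_of_notMem σ (hmeas j) (hnotMem h),
          ENNReal.toReal_zero]
    simp only [sum_apply, smul_apply,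
      Measure.toSignedMeasure_apply_measurable (hmeas j), hdirac, smul_eq_mul, mul_ite, mul_one,
      mul_zero, Finset.sum_ite_eq', Finset.mem_univ, if_true]
  refine le_antisymm ?_ ?_
  · calc totalVariationNorm X (∑ i, a i • (orbitMeasure σ (x i)).toSignedMeasure)
        ≤ ∑ i, totalVariationNorm X (a i • (orbitMeasure σ (x i)).toSignedMeasure) :=
          Finset.le_sum_of_subadditive _ (map_zero _).le (map_add_le_add _) _ _
      _ = ∑ i, |a i| := by
          simp only [map_smul_eq_mul, totalVariationNorm_orbitMeasure, mul_one, Real.norm_eq_abs]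
  · simpa only [hval] using sum_abs_apply_le_totalVariationNorm
      (∑ i, a i • (orbitMeasure σ (x i)).toSignedMeasure) hmeas hdisj

end Group

theorem lintegral_orbitMeasure_apply [Group G] [MulAction G X] [MeasurableSMul₂ G X]
    (σ : Measure G) [IsProbabilityMeasure σ] (μ : Measure X) [SFinite μ]
    [SMulInvariantMeasure G X μ] {s : Set X} (hs : MeasurableSet s) :
    ∫⁻ x, orbitMeasure σ x s ∂μ = μ s := by
  have hT : MeasurableSet {p : G × X | p.1 • p.2 ∈ s} := measurable_smul hs
  calc ∫⁻ x, orbitMeasure σ x s ∂μ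
      = σ.prod μ {p : G × X | p.1 • p.2 ∈ s} := by
        simp only [orbitMeasure_apply σ _ hs]
        exact (Measure.prod_apply_symm hT).symm
    _ = ∫⁻ g, μ ((g • ·) ⁻¹' s) ∂σ := Measure.prod_apply hT
    _ = μ s := by
        simp only [measure_preimage_smul_of_nullMeasurableSet hs.nullMeasurableSet,
          lintegral_const, measure_univ, mul_one]

theorem eq_smul_orbitMeasure_of_ae_mem_orbit [Group G] [MulAction G X] [MeasurableMul G]
    [MeasurableSMul₂ G X] (σ : Measure G) [IsProbabilityMeasure σ] [σ.IsMulRightInvariant]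
    (μ : Measure X) [SFinite μ] [SMulInvariantMeasure G X μ] {x : X}
    (hx : ∀ᵐ y ∂μ, y ∈ MulAction.orbit G x) : μ = μ univ • orbitMeasure σ x := by
  ext s hs
  have hconst : (fun y => orbitMeasure σ y s) =ᵐ[μ] fun _ => orbitMeasure σ x s := by
    filter_upwards [hx] with _ ⟨g, hg⟩
    rw [← hg, orbitMeasure_smul]
  rw [← lintegral_orbitMeasure_apply σ μ hs, lintegral_congr_ae hconst, lintegral_const,
    Measure.smul_apply, smul_eq_mul, mul_comm]

theorem eq_smul_toSignedMeasure_orbitMeasure_of_ae_mem_orbit [Group G] [MulAction G X]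
    [MeasurableMul G] [MeasurableSMul₂ G X] (σ : Measure G) [IsProbabilityMeasure σ]
    [σ.IsMulRightInvariant] {μ : SignedMeasure X} (hμ : μ ∈ invariantSignedMeasures G X) {x : X}
    (hx : ∀ᵐ y ∂μ.variation, y ∈ MulAction.orbit G x) :
    μ = μ univ • (orbitMeasure σ x).toSignedMeasure := by
  have := smulInvariantMeasure_posPart hμ
  have := smulInvariantMeasure_negPart hμ
  have hreal (ν : Measure X) [IsFiniteMeasure ν] [SMulInvariantMeasure G X ν]
      (hν : ν ≪ μ.variation) (s : Set X) : ν.real s = ν.real univ * (orbitMeasure σ x).real s := by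
    rw [measureReal_def ν univ, ← measureReal_ennreal_smul_apply,
      ← eq_smul_orbitMeasure_of_ae_mem_orbit σ ν (hν.ae_le hx)]
  have hjordan {s : Set X} (hs : MeasurableSet s) :
      μ s = μ.toJordanDecomposition.posPart.real s - μ.toJordanDecomposition.negPart.real s := by
    conv_lhs => rw [← SignedMeasure.toSignedMeasure_toJordanDecomposition μ]
    exact Measure.toSignedMeasure_sub_apply hs
  ext s hs
  rw [smul_apply, Measure.toSignedMeasure_apply_measurable hs, hjordan hs, hjordan .univ,
    smul_eq_mul, sub_mul, ← hreal _ (absolutelyContinuous_posPart_variation μ) s,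
    ← hreal _ (absolutelyContinuous_negPart_variation μ) s]

theorem eq_or_eq_neg_toSignedMeasure_orbitMeasure_of_ae_mem_orbit [Group G]
    [MulAction G X] [MeasurableMul G] [MeasurableSMul₂ G X] (σ : Measure G)
    [IsProbabilityMeasure σ] [σ.IsMulRightInvariant] {μ : SignedMeasure X}
    (hμ : μ ∈ invariantSignedMeasures G X) (hone : totalVariationNorm X μ = 1) {x : X}
    (hx : ∀ᵐ y ∂μ.variation, y ∈ MulAction.orbit G x) :
    μ = (orbitMeasure σ x).toSignedMeasure ∨ μ = -(orbitMeasure σ x).toSignedMeasure := by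
  have heq := eq_smul_toSignedMeasure_orbitMeasure_of_ae_mem_orbit σ hμ hx
  have habs : |μ univ| = 1 := by
    rw [heq, map_smul_eq_mul, totalVariationNorm_orbitMeasure, mul_one] at hone
    exact hone
  rcases eq_or_eq_neg_of_abs_eq habs with h | h
  · exact .inl (by rw [heq, h, one_smul])
  · exact .inr (by rw [heq, h]; exact neg_one_smul ℝ (orbitMeasure σ x).toSignedMeasure)

theorem exists_eq_or_eq_neg_orbitMeasure_of_mem_extremePoints [Group G] [MulAction G X]
    [TopologicalSpace X] [SecondCountableTopology X] [OpensMeasurableSpace X]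
    [ContinuousConstSMul G X] [T0Space (MulAction.orbitRel.Quotient G X)] [Nonempty X]
    [MeasurableMul G] [MeasurableSMul₂ G X] (σ : Measure G)
    [IsProbabilityMeasure σ] [σ.IsMulLeftInvariant] [σ.IsMulRightInvariant] {μ : SignedMeasure X}
    (hμ : μ ∈ extremePoints ℝ (invariantUnitBall G X)) :
    ∃ x, μ = (orbitMeasure σ x).toSignedMeasure ∨ μ = -(orbitMeasure σ x).toSignedMeasure := by
  obtain ⟨x, hx⟩ := exists_ae_mem_orbit_of_forall_measure_eq_zero_or_compl (G := G) μ.variation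
    fun _ hB hinv => variation_eq_zero_or_compl_of_mem_extremePoints hμ hB hinv
  refine ⟨x, eq_or_eq_neg_toSignedMeasure_orbitMeasure_of_ae_mem_orbit σ hμ.1.1 ?_ hx⟩
  exact seminorm_eq_one_of_mem_extremePoints_seminormBall hμ
    (toSignedMeasure_mem_invariantSignedMeasures (orbitMeasure σ x))
    (by rw [totalVariationNorm_orbitMeasure]; exact one_ne_zero)

end OrbitMeasure

section CompactGroup

variable {G X : Type*} [Group G] [TopologicalSpace G]

section Haar

variable [IsTopologicalGroup G] [CompactSpace G] [MeasurableSpace G] [BorelSpace G]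

theorem eq_of_isMulLeftInvariant_of_measure_univ_eq (ν σ : Measure G) [σ.IsHaarMeasure]
    [ν.IsMulLeftInvariant] [IsFiniteMeasureOnCompacts ν] (h : ν univ = σ univ) : ν = σ := by
  have hν := Measure.isMulInvariant_eq_smul_of_compactSpace ν σ
  rw [hν, Measure.smul_apply, ENNReal.smul_def, smul_eq_mul] at h
  have hone := (ENNReal.mul_eq_right (NeZero.ne _) isCompact_univ.measure_ne_top).1 h
  rw [hν, ENNReal.coe_eq_one.1 hone, one_smul]

instance isMulRightInvariant_of_compactSpace (σ : Measure G) [σ.IsHaarMeasure] :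
    σ.IsMulRightInvariant :=
  ⟨fun g => eq_of_isMulLeftInvariant_of_measure_univ_eq _ σ <| by
    rw [Measure.map_apply (measurable_mul_const g) .univ, preimage_univ]⟩

instance isInvInvariant_of_compactSpace (σ : Measure G) [σ.IsHaarMeasure] :
    σ.IsInvInvariant :=
  ⟨eq_of_isMulLeftInvariant_of_measure_univ_eq _ σ <| by
    rw [Measure.inv_apply, inv_univ]⟩

end Haar

variable [TopologicalSpace X] [MulAction G X]

instance properSMul_of_compactSpace [CompactSpace G] [T2Space X] [ContinuousSMul G X] :
    ProperSMul G X :=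
  properSMul_iff_continuousSMul_ultrafilter_tendsto_t2.2 ⟨inferInstance, fun 𝒰 _ _ _ =>
    ⟨(𝒰.map Prod.fst).lim, (𝒰.map Prod.fst).le_nhds_lim⟩⟩

theorem measurableSet_orbit [CompactSpace G] [T2Space X] [ContinuousSMul G X]
    [MeasurableSpace X] [OpensMeasurableSpace X] (x : X) :
    MeasurableSet (MulAction.orbit G x) :=
  (isCompact_range (continuous_id.smul continuous_const)).measurableSet

end CompactGroup

theorem mainTheorem12_general (G X : Type*) [Group G] [TopologicalSpace G] [IsTopologicalGroup G]
    [CompactSpace G] [MeasurableSpace G] [BorelSpace G] [TopologicalSpace X] [T2Space X]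
    [SecondCountableTopology X] [Nonempty X] [MeasurableSpace X] [BorelSpace X] [MulAction G X]
    [ContinuousSMul G X] (σ : Measure G) [σ.IsHaarMeasure] [IsProbabilityMeasure σ] :
    (∀ x : X, (orbitMeasure σ x).toSignedMeasure ∈ invariantSignedMeasures G X) ∧
    (∀ (x : X) (ψ : X → ℝ), StronglyMeasurable ψ → (∀ (g : G) (y : X), ψ (g • y) = ψ y) →
      (orbitMeasure σ x).toSignedMeasure.Integrable ψ ∧
        ∫ᵛ y, ψ y ∂<•(orbitMeasure σ x).toSignedMeasure = ψ x) ∧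
    (∀ (x : X) (g : G),
      (orbitMeasure σ x).toSignedMeasure = (orbitMeasure σ (g • x)).toSignedMeasure) ∧
    (∀ x : X, totalVariationNorm X (orbitMeasure σ x).toSignedMeasure = 1) ∧
    (∀ (N : ℕ) (x : Fin N → X) (a : Fin N → ℝ), (∀ i j, i ≠ j → ∀ g : G, x i ≠ g • x j) →
      totalVariationNorm X (∑ n, a n • (orbitMeasure σ (x n)).toSignedMeasure) = ∑ n, |a n|) ∧
    (∀ e ∈ extremePoints ℝ (invariantUnitBall G X),
      ∃ x, e = (orbitMeasure σ x).toSignedMeasure ∨ e = -(orbitMeasure σ x).toSignedMeasure) := by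
  refine ⟨fun x => toSignedMeasure_mem_invariantSignedMeasures _, fun x ψ hψ hinv => ⟨?_, ?_⟩,
    fun x g => Measure.toSignedMeasure_congr (orbitMeasure_smul σ g x).symm,
    totalVariationNorm_orbitMeasure σ,
    fun N x a hx => totalVariationNorm_sum_smul_orbitMeasure σ (fun i => measurableSet_orbit _)
      hx a,
    fun e he => exists_eq_or_eq_neg_orbitMeasure_of_mem_extremePoints σ he⟩
  · rw [VectorMeasure.Integrable, Measure.variation_toSignedMeasure]
    exact integrable_orbitMeasure_of_forall_smul_eq σ hψ fun g => hinv g x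
  · rw [VectorMeasure.integral_toSignedMeasure,
      integral_orbitMeasure_of_forall_smul_eq σ hψ fun g => hinv g x]

namespace KPlaneDomain

variable {d k : ℕ}

instance instMulAction : MulAction (OrthGroup (d - k)) (KPlaneDomain d k) where
  smul := rotate
  one_smul _ := Prod.ext (Subtype.ext (Matrix.one_mul _)) (Matrix.one_mulVec _)
  mul_smul U V ξ :=
    Prod.ext (Subtype.ext (Matrix.mul_assoc _ _ _)) (Matrix.mulVec_mulVec ξ.2 U.1 V.1).symm

instance instContinuousSMul : ContinuousSMul (OrthGroup (d - k)) (KPlaneDomain d k) where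
  continuous_smul := by
    change Continuous fun p : OrthGroup (d - k) × KPlaneDomain d k => rotate p.1 p.2
    unfold rotate
    fun_prop

end KPlaneDomain

instance OrthGroup.isHaarMeasure_haarProb (n : ℕ) : (OrthGroup.haarProb n).IsHaarMeasure :=
  inferInstanceAs (Measure.haarMeasure _).IsHaarMeasure

theorem Stiefel.nonempty {m d : ℕ} (h : m ≤ d) : Nonempty (Stiefel m d) := by
  refine ⟨⟨Matrix.of fun i j => if Fin.castLE h i = j then 1 else 0, ?_⟩⟩
  ext i j
  simp [Matrix.mul_apply, Matrix.one_apply, eq_comm]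

theorem diracIso_eq_toSignedMeasure_orbitMeasure {d k : ℕ} (ξ : KPlaneDomain d k) :
    diracIso ξ = (orbitMeasure (OrthGroup.haarProb (d - k)) ξ).toSignedMeasure := by
  refine Measure.toSignedMeasure_congr ?_
  have hmeas : Measurable fun U : OrthGroup (d - k) => U • ξ := measurable_smul_const ξ
  calc isoProj (Measure.dirac ξ)
      = (OrthGroup.haarProb (d - k)).bind fun U => Measure.dirac (U⁻¹ • ξ) := by
        simp only [isoProj]
        congr! with U
        exact Measure.map_dirac' (measurable_const_smul U⁻¹) ξ
    _ = (OrthGroup.haarProb (d - k)).map fun U => U⁻¹ • ξ :=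
        Measure.bind_dirac_eq_map _ (hmeas.comp measurable_inv)
    _ = orbitMeasure (OrthGroup.haarProb (d - k)).inv ξ :=
        (Measure.map_map hmeas measurable_inv).symm
    _ = orbitMeasure (OrthGroup.haarProb (d - k)) ξ := by rw [Measure.inv_eq_self]

theorem mainTheorem12 (d k : ℕ) (hk : 1 ≤ k) (hkd : k < d) :
    -- membership in `M_iso(Ξ_k)`
    (∀ ξ₀ : KPlaneDomain d k, diracIso ξ₀ ∈ measIso d k) ∧
    -- sampling
    (∀ (ξ₀ : KPlaneDomain d k) (ψ : ZeroAtInftyContinuousMap (KPlaneDomain d k) ℝ),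
      IsIsotropic ψ →
        (diracIso ξ₀).Integrable (fun ξ => ψ ξ) ∧ ∫ᵛ ξ, ψ ξ ∂<•(diracIso ξ₀) = ψ ξ₀) ∧
    -- rotation invariance
    (∀ (ξ₀ : KPlaneDomain d k) (U : OrthGroup (d - k)),
      diracIso ξ₀ = diracIso (KPlaneDomain.rotate U ξ₀)) ∧
    -- unit norm
    (∀ ξ₀ : KPlaneDomain d k, measNorm (diracIso ξ₀) = 1) ∧
    -- linear combinations at points that represent pairwise distinct `k`-planes
    (∀ (N : ℕ) (ξ : Fin N → KPlaneDomain d k) (a : Fin N → ℝ),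
      (∀ i j, i ≠ j → ∀ U : OrthGroup (d - k), ξ i ≠ KPlaneDomain.rotate U (ξ j)) →
        measNorm (∑ n, a n • diracIso (ξ n)) = ∑ n, |a n|) ∧
    -- extreme points of the unit ball of `M_iso(Ξ_k)`
    (∀ e ∈ Set.extremePoints ℝ (measIsoBall d k),
      ∃ ξ₀ : KPlaneDomain d k, e = diracIso ξ₀ ∨ e = -diracIso ξ₀) := by
  have := Stiefel.nonempty (Nat.sub_le d k)
  obtain ⟨hmem, hsampling, hrotate, hnorm, hcombination, hextreme⟩ :=
    mainTheorem12_general (OrthGroup (d - k)) (KPlaneDomain d k) (OrthGroup.haarProb (d - k))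
  -- `measIso`, `measNorm` and `measIsoBall` agree definitionally with their general counterparts.
  simp only [diracIso_eq_toSignedMeasure_orbitMeasure]
  exact ⟨hmem, fun ξ₀ ψ hψ => hsampling ξ₀ ψ (map_continuous ψ).stronglyMeasurable hψ,
    hrotate, hnorm, hcombination, hextreme⟩
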